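/- Let $M$ be a smooth manifold, $A\to M$ a smooth real vector bundle of finite rank and $A^*\to M$ its dual bundle. Suppose that $A$ carries a Lie algebroid structure $([\cdot,\cdot],\rho)$ and $A^*$ a Lie algebroid structure $([\cdot,\cdot]_*,\rho_*)$: in each case a smooth bundle map to $TM$ (the anchor) and a real Lie algebra structure on the sections such that the anchor preserves brackets and $[X,fY]=f[X,Y]+(\rho(X)f)Y$. Let $\phi_0\in\Gamma(A^*)$ be a 1-cocycle of $A$, that is $\phi_0([X,Y])=\rho(X)(\phi_0(Y))-\rho(Y)(\phi_0(X))$, and let $X_0\in\Gamma(A)$ be a 1-cocycle of $A^*$. Let $d$ be the Lie algebroid differential of $A$ on $\Gamma(\wedge^\bullet A^*)$, $d^{\phi_0}\alpha=d\alpha+\phi_0\wedge\alpha$, and $\mathcal L^{\phi_0}_X\alpha=d^{\phi_0}\iota_X\alpha+\iota_Xd^{\phi_0}\alpha$ for $X\in\Gamma(A)$. Let $[\cdot,\cdot]$ also denote the Schouten bracket of $\Gamma(\wedge^\bullet A)$, with $[X,f]=\rho(X)f$, and let $$[P,P']^{\phi_0}=[P,P']+(r-1)\,P\wedge\iota_{\phi_0}P'-(-1)^{r-1}(r'-1)\,(\iota_{\phi_0}P)\wedge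 P'$$ for $P\in\Gamma(\wedge^rA)$, $P'\in\Gamma(\wedge^{r'}A)$. For $X\in\Gamma(A)$ and $P\in\Gamma(\wedge^pA)$ put $\mathcal L^{\phi_0}_XP=[X,P]^{\phi_0}$. Let $d_*^{X_0}$, $\mathcal L_*^{X_0}$ and $[\cdot,\cdot]_*^{X_0}$ be the same objects for the Lie algebroid $A^*$ with its 1-cocycle $X_0$, where $A^{**}$ is identified with $A$; thus $d_*^{X_0}$ acts on $\Gamma(\wedge^\bullet A)$. The pair $((A,\phi_0),(A^*,X_0))$ is called a generalized Lie bialgebroid if for all $X,Y\in\Gamma(A)$, all $p\ge 0$ and all $P\in\Gamma(\wedge^pA)$ $$d_*^{X_0}[X,Y]=[d_*^{X_0}X,Y]^{\phi_0}+[X,d_*^{X_0}Y]^{\phi_0},\qquad \mathcal L^{X_0}_{*\phi_0}P+\mathcal L^{\phi_0}_{X_0}P=0 .$$ **Theorem.** If $((A,\phi_0),(A^*,X_0))$ is a generalized Lie bialgebroid, then $((A^*,X_0),(A,\phi_0))$ is also a generalized Lie bialgebroid; that is, for all $\xi,\eta\in\Gamma(A^*)$, all $p\ge 0$ and all $Q\in\Gamma(\wedge^pA^*)$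 $$d^{\phi_0}[\xi,\eta]_*=[d^{\phi_0}\xi,\eta]_*^{X_0}+[\xi,d^{\phi_0}\eta]_*^{X_0},\qquad \mathcal L^{\phi_0}_{X_0}Q+\mathcal L^{X_0}_{*\phi_0}Q=0 .$$ -/

import Mathlib

open Bundle Manifold
open scoped ContDiff

noncomputable section

set_option linter.unusedSectionVars false

namespace GenLieBialgebroid

/-! ## Smooth functions, sections, the dual bundle -/

section Sections

variable {E : Type*} [NormedAddCommGroup E] [NormedSpace ℝ E]
  {H : Type*} [TopologicalSpace H] (I : ModelWithCorners ℝ E H)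
  {M : Type*} [TopologicalSpace M] [ChartedSpace H M]
  (F : Type*) [NormedAddCommGroup F] [NormedSpace ℝ F]
  (V : M → Type*) [TopologicalSpace (TotalSpace F V)]
  [∀ x, TopologicalSpace (V x)] [∀ x, AddCommGroup (V x)] [∀ x, Module ℝ (V x)]
  [FiberBundle F V] [VectorBundle ℝ F V]

/-- The algebra `C^∞(M)`. -/
abbrev Smooth (M : Type*) [TopologicalSpace M] [ChartedSpace H M] : Type _ := C^∞⟮I, M; ℝ⟯

/-- The space `Γ(V)` of smooth sections of the vector bundle `V`. -/
abbrev Sec : Type _ := Cₛ^∞⟮I; F, V⟯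

/-- The fibres of the dual bundle `V*`; its model fibre is `F →L[ℝ] ℝ`. -/
abbrev DualBundle (x : M) : Type _ := V x →L[ℝ] Bundle.Trivial M ℝ x

variable {I F V}

instance : SMul (Smooth I M) (Sec I F V) :=
  ⟨fun f X => ⟨fun x => f x • X x, f.contMDiff.smul_section X.contMDiff⟩⟩

@[simp] theorem smul_apply (f : Smooth I M) (X : Sec I F V) (x : M) : (f • X) x = f x • X x := rfl

/-- `Γ(V)` is a module over `C^∞(M)` by pointwise multiplication. -/
instance : Module (Smooth I M) (Sec I F V) where
  one_smul X := by ext x; simp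
  mul_smul f g X := by ext x; simp [mul_smul]
  smul_zero f := by ext x; simp
  smul_add f X Y := by ext x; simp
  add_smul f g X := by ext x; simp [add_smul]
  zero_smul X := by ext x; simp

variable (I F V)

/-- The `C^∞(M)`-bilinear pairing `Γ(V) × Γ(V*) → C^∞(M)`, `⟨X, ξ⟩(x) = ξ_x(X_x)`. -/
def dualPairing :
    Sec I F V →ₗ[Smooth I M] Sec I (F →L[ℝ] ℝ) (DualBundle V) →ₗ[Smooth I M] Smooth I M :=
  LinearMap.mk₂ (Smooth I M)
    (fun X ξ => ⟨fun x => ξ x (X x), by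
      intro x
      have h := (ξ.contMDiff x).clm_bundle_apply (X.contMDiff x)
      rw [contMDiffAt_section] at h
      exact h⟩)
    (fun X Y ξ => by ext x; exact map_add (ξ x) (X x) (Y x))
    (fun f X ξ => by ext x; exact map_smul (ξ x) (f x) (X x))
    (fun X ξ η => by ext x; rfl)
    (fun f X ξ => by ext x; rfl)

@[simp] theorem dualPairing_apply (X : Sec I F V) (ξ : Sec I (F →L[ℝ] ℝ) (DualBundle V)) (x : M) :
    dualPairing I F V X ξ x = ξ x (X x) := rfl

/-- A function times a locally defined smooth section, extended by zero. -/
theorem exists_cutoff_section {I : ModelWithCorners ℝ E H} {F' : Type*} [NormedAddCommGroup F'] [NormedSpace ℝ F']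
    {W : M → Type*} [TopologicalSpace (TotalSpace F' W)]
    [∀ x, TopologicalSpace (W x)] [∀ x, AddCommGroup (W x)] [∀ x, Module ℝ (W x)]
    [FiberBundle F' W] [VectorBundle ℝ F' W]
    {u : Set M} (hu : IsOpen u) (ψ : Smooth I M) (hψ : tsupport ψ ⊆ u)
    (s : ∀ x, W x) (hs : ContMDiffOn I (I.prod 𝓘(ℝ, F')) ∞ (fun x => TotalSpace.mk' F' x (s x)) u) :
    ∃ X : Sec I F' W, ∀ x, X x = ψ x • s x :=
  ⟨⟨fun x => ψ x • s x,
    ContMDiffOn.smul_section_of_tsupport ψ.contMDiff.contMDiffOn hu hψ hs⟩, fun _ => rfl⟩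

/-- Gluing: a section given near every point by a smooth one up to a nonvanishing factor. -/
theorem contMDiff_of_local {I : ModelWithCorners ℝ E H} {F' : Type*} [NormedAddCommGroup F'] [NormedSpace ℝ F']
    {W : M → Type*} [TopologicalSpace (TotalSpace F' W)]
    [∀ x, TopologicalSpace (W x)] [∀ x, AddCommGroup (W x)] [∀ x, Module ℝ (W x)]
    [FiberBundle F' W] [VectorBundle ℝ F' W] (s : ∀ x, W x)
    (h : ∀ x₀, ∃ (ψ : Smooth I M) (Y : Sec I F' W), ψ x₀ ≠ 0 ∧ ∀ x, ψ x • s x = Y x) :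
    ContMDiff I (I.prod 𝓘(ℝ, F')) ∞ (fun x => TotalSpace.mk' F' x (s x)) := by
  intro x₀
  obtain ⟨ψ, Y, h0, hY⟩ := h x₀
  have hψ : ContMDiffAt I 𝓘(ℝ) ∞ (fun x => (ψ x)⁻¹) x₀ :=
    ((contDiffAt_inv ℝ h0).contMDiffAt).comp x₀ (ψ.contMDiff x₀)
  refine (hψ.smul_section (Y.contMDiff x₀)).congr_of_eventuallyEq ?_
  filter_upwards [ψ.contMDiff.continuous.continuousAt.eventually_ne h0] with x hx
  simp [← hY, smul_smul, hx]

end Sections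

section Perfect

variable {E : Type*} [NormedAddCommGroup E] [NormedSpace ℝ E] [FiniteDimensional ℝ E]
  {H : Type*} [TopologicalSpace H] {I : ModelWithCorners ℝ E H}
  {M : Type*} [TopologicalSpace M] [ChartedSpace H M] [IsManifold I ∞ M] [T2Space M]
  {F : Type*} [NormedAddCommGroup F] [NormedSpace ℝ F] [FiniteDimensional ℝ F]
  {V : M → Type*} [TopologicalSpace (TotalSpace F V)]
  [∀ x, TopologicalSpace (V x)] [∀ x, AddCommGroup (V x)] [∀ x, Module ℝ (V x)]
  [FiberBundle F V] [VectorBundle ℝ F V] [ContMDiffVectorBundle ∞ F V I]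

/-- Local dual bases: near each point a multiple of the identity of `V` is a finite sum of global
sections of `V ⊗ V*`. -/
theorem exists_local_dual_basis (x₀ : M) :
    ∃ (n : ℕ) (e : Fin n → Sec I F V) (ε : Fin n → Sec I (F →L[ℝ] ℝ) (DualBundle V))
      (ψ : Smooth I M), ψ x₀ = 1 ∧ ∀ x (v : V x), ψ x • v = ∑ i, (ε i x v : ℝ) • e i x := by
  classical
  let t := trivializationAt F V x₀
  let b := Module.finBasis ℝ F
  have hx₀ : x₀ ∈ t.baseSet := FiberBundle.mem_baseSet_trivializationAt F V x₀
  obtain ⟨φ, -, hφ⟩ := (SmoothBumpFunction.nhds_basis_tsupport (I := I) x₀).mem_iff.1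
    (t.open_baseSet.mem_nhds hx₀)
  let ψ : Smooth I M := ⟨φ, φ.contMDiff⟩
  have hs (i) := t.contMDiffOn_localFrame_baseSet (I := I) ∞ b i
  choose e he using fun i => exists_cutoff_section t.open_baseSet ψ hφ _ (hs i)
  let σ (i) (x : M) : DualBundle V x :=
    (LinearMap.toContinuousLinearMap (b.coord i)).comp (t.continuousLinearMapAt ℝ x)
  have hσ (i) : ContMDiffOn I (I.prod 𝓘(ℝ, F →L[ℝ] ℝ)) ∞
      (fun x => TotalSpace.mk' (F →L[ℝ] ℝ) (E := DualBundle V) x (σ i x)) t.baseSet := by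
    let t' := trivializationAt (F →L[ℝ] ℝ) (DualBundle V) x₀
    have ht' : t'.baseSet = t.baseSet := by
      simp [t', t]
    rw [← ht', t'.contMDiffOn_section_baseSet_iff]
    refine (contMDiffOn_const (c := LinearMap.toContinuousLinearMap (b.coord i))).congr ?_
    intro x hx
    rw [ht'] at hx
    ext v
    have key : b.coord i (t.continuousLinearMapAt ℝ x (t.symmL ℝ x v)) = b.coord i v := by
      rw [t.continuousLinearMapAt_symmL hx]
    rw [hom_trivializationAt_apply]
    simpa [ContinuousLinearMap.inCoordinates, σ, t] using key
  choose ε hε using fun i => exists_cutoff_section t.open_baseSet ψ hφ _ (hσ i)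
  refine ⟨_, e, ε, ψ * ψ, ?_, fun x v => ?_⟩
  on_goal 1 =>
    change φ x₀ * φ x₀ = 1
    rw [φ.eq_one, one_mul]
  by_cases hx : x ∈ t.baseSet
  · have h := congrArg (t.symmL ℝ x) (b.sum_repr (t.continuousLinearMapAt ℝ x v))
    rw [t.symmL_continuousLinearMapAt hx, map_sum] at h
    change (ψ x * ψ x) • v = _
    conv_lhs => rw [← h, Finset.smul_sum]
    refine Finset.sum_congr rfl fun i _ => ?_
    have h1 : (ε i x v : ℝ) = ψ x * b.repr (t.continuousLinearMapAt ℝ x v) i := by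
      rw [hε]; rfl
    have h2 : t.localFrame b i x = t.symmL ℝ x (b i) := by
      rw [t.localFrame_apply_of_mem_baseSet b hx]
      simp [Trivialization.basisAt, t.symmL_apply hx]
    rw [h1, he, h2, map_smul, smul_smul, smul_smul]
    congr 1
    ring
  · have : ψ x = 0 := image_eq_zero_of_notMem_tsupport fun h => hx (hφ h)
    simp [he, this]

/-- The pairing `Γ(V) × Γ(V*) → C^∞(M)` is perfect over `C^∞(M)`. -/
instance dualPairing_isPerfPair : (dualPairing I F V).IsPerfPair := by
  choose n e ε ψ h1 h using exists_local_dual_basis (I := I) (F := F) (V := V)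
  have hV (x : M) (v : V x) : v = ∑ i, (ε x i x v : ℝ) • e x i x := by
    rw [← h, h1, one_smul]
  have sep (x : M) (v w : V x)
      (hvw : ∀ ξ : Sec I (F →L[ℝ] ℝ) (DualBundle V), ξ x v = ξ x w) : v = w := by
    rw [hV x v, hV x w]
    simp only [hvw]
  have sep' (x : M) (v w : DualBundle V x)
      (hvw : ∀ X : Sec I F V, v (X x) = w (X x)) : v = w := by
    ext u
    rw [hV x u, map_sum, map_sum]
    simp only [map_smul, hvw]
  have id1 (p : M) (X : Sec I F V) : ∑ i, dualPairing I F V X (ε p i) • e p i = ψ p • X := by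
    ext x
    rw [smul_apply, h p x (X x), ← ContMDiffSection.coeAddHom_apply, map_sum, Finset.sum_apply]
    rfl
  have id2 (p : M) (ξ : Sec I (F →L[ℝ] ℝ) (DualBundle V)) :
      ∑ i, dualPairing I F V (e p i) ξ • ε p i = ψ p • ξ := by
    ext x v
    rw [smul_apply, ← ContMDiffSection.coeAddHom_apply, map_sum, Finset.sum_apply]
    change _ = ψ p x • ξ x v
    rw [← map_smul, h p x v, map_sum, sum_apply]
    refine Finset.sum_congr rfl fun i _ => ?_
    exact (mul_comm _ _).trans (map_smul (ξ x) (ε p i x v) (e p i x)).symm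
  refine ⟨⟨?_, fun Φ => ?_⟩, ⟨?_, fun Φ => ?_⟩⟩
  · intro X Y hXY
    ext x
    exact sep x _ _ fun ξ => by
      rw [← dualPairing_apply, ← dualPairing_apply, hXY]
  · let Y (p : M) : Sec I F V := ∑ i, Φ (ε p i) • e p i
    have hY (p : M) (ξ) (x : M) : ξ x (Y p x) = ψ p x * Φ ξ x := by
      have : dualPairing I F V (Y p) ξ = ψ p * Φ ξ := by
        rw [← smul_eq_mul, ← map_smul, ← id2, map_sum, map_sum, LinearMap.sum_apply]
        refine Finset.sum_congr rfl fun i _ => ?_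
        rw [map_smul, map_smul, LinearMap.smul_apply, smul_eq_mul, smul_eq_mul, mul_comm]
      rw [← dualPairing_apply, this]
      rfl
    have hX (x : M) (ξ : Sec I (F →L[ℝ] ℝ) (DualBundle V)) : ξ x (Y x x) = Φ ξ x := by
      rw [hY, h1, one_mul]
    refine ⟨⟨fun x => Y x x, contMDiff_of_local _ fun p => ⟨ψ p, Y p, by simp [h1],
      fun x => sep x _ _ fun ξ => ?_⟩⟩, ?_⟩
    · rw [map_smul, hX, hY]; rfl
    · ext ξ x
      exact hX x ξ
  · intro ξ η hξη
    ext1 x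
    exact sep' x _ _ fun X => by
      rw [← dualPairing_apply, ← dualPairing_apply]
      exact congrArg (fun L => L X x) hξη
  · let Y (p : M) : Sec I (F →L[ℝ] ℝ) (DualBundle V) := ∑ i, Φ (e p i) • ε p i
    have hY (p : M) (X : Sec I F V) (x : M) : Y p x (X x) = ψ p x * Φ X x := by
      have : dualPairing I F V X (Y p) = ψ p * Φ X := by
        rw [← smul_eq_mul, ← map_smul, ← id1, map_sum, map_sum]
        refine Finset.sum_congr rfl fun i _ => ?_
        rw [map_smul, map_smul, smul_eq_mul, smul_eq_mul, mul_comm]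
      rw [← dualPairing_apply, this]
      rfl
    have hX (x : M) (X : Sec I F V) : Y x x (X x) = Φ X x := by
      rw [hY, h1, one_mul]
    refine ⟨⟨fun x => Y x x, contMDiff_of_local _ fun p => ⟨ψ p, Y p, by simp [h1],
      fun x => sep' x _ _ fun X => ?_⟩⟩, ?_⟩
    · rw [hY, ← hX x X]; rfl
    · ext X x
      exact hX x X

end Perfect

/-! ## Lie algebroids -/

section LieAlgebroid

variable {E : Type*} [NormedAddCommGroup E] [NormedSpace ℝ E]
  {H : Type*} [TopologicalSpace H] (I : ModelWithCorners ℝ E H)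
  {M : Type*} [TopologicalSpace M] [ChartedSpace H M] [IsManifold I ∞ M]
  (F : Type*) [NormedAddCommGroup F] [NormedSpace ℝ F]
  (V : M → Type*) [TopologicalSpace (TotalSpace F V)]
  [∀ x, TopologicalSpace (V x)] [∀ x, AddCommGroup (V x)] [∀ x, Module ℝ (V x)]
  [FiberBundle F V] [VectorBundle ℝ F V]

/-- A smooth vector bundle map `ρ : V → TM` over the identity of `M`. -/
structure AnchorMap where
  /-- the linear maps `ρ_x : V_x → T_xM` -/
  anchor : ∀ x, V x →L[ℝ] TangentSpace I x
  contMDiff_anchor : ContMDiff (I.prod 𝓘(ℝ, F)) I.tangent ∞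
    (fun v : TotalSpace F V => (⟨v.1, anchor v.1 v.2⟩ : TangentBundle I M))

variable {I F V}

/-- The function `ρ(X)f ∈ C^∞(M)`, `(ρ(X)f)(x) = df_x(ρ_x(X_x))`. -/
def AnchorMap.deriv (ρ : AnchorMap I F V) (X : Sec I F V) (f : Smooth I M) : Smooth I M :=
  ⟨fun x => mfderiv I 𝓘(ℝ) f x (ρ.anchor x (X x)), by
    have h1 : ContMDiff I.tangent 𝓘(ℝ).tangent ∞ (tangentMap I 𝓘(ℝ) f) :=
      f.contMDiff.contMDiff_tangentMap (by simp)
    have h2 := h1.comp (ρ.contMDiff_anchor.comp X.contMDiff)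
    exact (contMDiff_snd_tangentBundle_modelSpace ℝ 𝓘(ℝ)).comp h2⟩

theorem AnchorMap.deriv_add (ρ : AnchorMap I F V) (X : Sec I F V) (f g : Smooth I M) :
    ρ.deriv X (f + g) = ρ.deriv X f + ρ.deriv X g := by
  ext x
  have hf := (f.contMDiff.mdifferentiable (by simp) x).hasMFDerivAt
  have hg := (g.contMDiff.mdifferentiable (by simp) x).hasMFDerivAt
  exact congrArg (fun L => L (ρ.anchor x (X x))) (hf.add hg).mfderiv

theorem AnchorMap.deriv_mul (ρ : AnchorMap I F V) (X : Sec I F V) (f g : Smooth I M) :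
    ρ.deriv X (f * g) = f * ρ.deriv X g + ρ.deriv X f * g := by
  ext x
  have hf := (f.contMDiff.mdifferentiable (by simp) x).hasMFDerivAt
  have hg := (g.contMDiff.mdifferentiable (by simp) x).hasMFDerivAt
  refine (congrArg (fun L => L (ρ.anchor x (X x))) (hf.mul hg).mfderiv).trans ?_
  change f x * ρ.deriv X g x + g x * ρ.deriv X f x = f x * ρ.deriv X g x + ρ.deriv X f x * g x
  rw [mul_comm (g x)]

variable (I F V)

/-- A Lie algebroid structure on the vector bundle `V`: an anchor `ρ : V → TM` and a real Lie
algebra structure on `Γ(V)` such that `ρ` preserves brackets and the Leibniz rule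
`[X, fY] = f[X, Y] + (ρ(X)f)Y` holds. -/
structure LieAlgebroid extends AnchorMap I F V where
  /-- the Lie bracket of sections -/
  bracket : Sec I F V →ₗ[ℝ] Sec I F V →ₗ[ℝ] Sec I F V
  bracket_self : ∀ X, bracket X X = 0
  jacobi : ∀ X Y Z,
    bracket X (bracket Y Z) + bracket Y (bracket Z X) + bracket Z (bracket X Y) = 0
  anchor_bracket : ∀ X Y x, anchor x (bracket X Y x) =
    VectorField.mlieBracket I (fun y => anchor y (X y)) (fun y => anchor y (Y y)) x
  leibniz : ∀ (f : Smooth I M) X Y,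
    bracket X (f • Y) = f • bracket X Y + toAnchorMap.deriv X f • Y

end LieAlgebroid

/-! ## Cartan calculus in the presence of a 1-cocycle

A `p`-form of a Lie algebroid on `V` is a `C^∞(M)`-multilinear alternating map
`Γ(V)^p → C^∞(M)`. The operators below are given by formulas which make sense for every
function `Γ(V)^p → C^∞(M)`, and are written for these. -/

section Cartan

variable {E : Type*} [NormedAddCommGroup E] [NormedSpace ℝ E]
  {H : Type*} [TopologicalSpace H] {I : ModelWithCorners ℝ E H}
  {M : Type*} [TopologicalSpace M] [ChartedSpace H M] [IsManifold I ∞ M]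
  {F : Type*} [NormedAddCommGroup F] [NormedSpace ℝ F]
  {V : M → Type*} [TopologicalSpace (TotalSpace F V)]
  [∀ x, TopologicalSpace (V x)] [∀ x, AddCommGroup (V x)] [∀ x, Module ℝ (V x)]
  [FiberBundle F V] [VectorBundle ℝ F V]

variable (I F V) in
/-- Functions of `p` sections of `V` with values in `C^∞(M)`. -/
abbrev Cochain (p : ℕ) : Type _ := (Fin p → Sec I F V) → Smooth I M

/-- `φ ∧ α` for a 1-form `φ`:
`(φ ∧ α)(X₀, …, X_p) = ∑ i, (-1)^i φ(X_i) α(X₀, …, X̂_i, …, X_p)`. -/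
def wedgeOne (φ : Sec I F V → Smooth I M) {p : ℕ} (α : Cochain I F V p) : Cochain I F V (p + 1) :=
  fun X => ∑ i : Fin (p + 1), (-1 : ℝ) ^ (i : ℕ) • (φ (X i) * α (i.removeNth X))

/-- The contraction `ι_X α = α(X, ·, …, ·)`. -/
def contract (X : Sec I F V) {p : ℕ} (α : Cochain I F V (p + 1)) : Cochain I F V p :=
  fun Y => α (Fin.cons X Y)

namespace LieAlgebroid

variable (A : LieAlgebroid I F V)

/-- The Lie algebroid differential,
`(dα)(X₀, …, X_p) = ∑ i, (-1)^i ρ(X_i)(α(X₀, …, X̂_i, …, X_p))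
  + ∑ i < j, (-1)^(i+j) α([X_i, X_j], X₀, …, X̂_i, …, X̂_j, …, X_p)`.
The second sum runs over the pairs `(i, j + 1)` with `i ≤ j`; it is empty when `p = 0`. -/
def d : {p : ℕ} → Cochain I F V p → Cochain I F V (p + 1)
  | 0, α => fun X => A.deriv (X 0) (α (Fin.removeNth 0 X))
  | p + 1, α => fun X =>
      (∑ i : Fin (p + 2), (-1 : ℝ) ^ (i : ℕ) • A.deriv (X i) (α (i.removeNth X))) +
      ∑ i : Fin (p + 1), ∑ j ∈ Finset.Ici i, (-1 : ℝ) ^ ((i : ℕ) + (j + 1 : ℕ)) •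
        α (Fin.cons (A.bracket (X i.castSucc) (X j.succ)) (i.removeNth (j.succ.removeNth X)))

/-- `φ` is a 1-cocycle: `φ([X, Y]) = ρ(X)(φ(Y)) - ρ(Y)(φ(X))`. -/
def IsCocycle (φ : Sec I F V → Smooth I M) : Prop :=
  ∀ X Y, φ (A.bracket X Y) = A.deriv X (φ Y) - A.deriv Y (φ X)

/-- The `φ`-deformed differential `d^φ α = dα + φ ∧ α`. -/
def dDef (φ : Sec I F V → Smooth I M) {p : ℕ} (α : Cochain I F V p) : Cochain I F V (p + 1) :=
  A.d α + wedgeOne φ α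

/-- The `φ`-deformed Lie derivative of forms `L^φ_X α = d^φ(ι_X α) + ι_X(d^φ α)`, where
`ι_X α = 0` in degree zero. -/
def lieDef (φ : Sec I F V → Smooth I M) (X : Sec I F V) :
    {p : ℕ} → Cochain I F V p → Cochain I F V p
  | 0, α => contract X (A.dDef φ α)
  | _ + 1, α => A.dDef φ (contract X α) + contract X (A.dDef φ α)

end LieAlgebroid

end Cartan

/-! ## Multisections, Schouten bracket, generalized Lie bialgebroids

`V` and `W` are vector bundles in duality by a perfect pairing `B : Γ(V) × Γ(W) → C^∞(M)`.
Multisections of `V` of degree `p` are the `C^∞(M)`-multilinear alternating maps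
`Γ(W)^p → C^∞(M)`; a section `X` of `V` is the map `ξ ↦ ⟨X, ξ⟩`. Thus they are at the same time
the `p`-forms of a Lie algebroid structure on `W`. -/

section Bialgebroid

variable {E : Type*} [NormedAddCommGroup E] [NormedSpace ℝ E]
  {H : Type*} [TopologicalSpace H] {I : ModelWithCorners ℝ E H}
  {M : Type*} [TopologicalSpace M] [ChartedSpace H M] [IsManifold I ∞ M]
  {F : Type*} [NormedAddCommGroup F] [NormedSpace ℝ F]
  {V : M → Type*} [TopologicalSpace (TotalSpace F V)]
  [∀ x, TopologicalSpace (V x)] [∀ x, AddCommGroup (V x)] [∀ x, Module ℝ (V x)]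
  [FiberBundle F V] [VectorBundle ℝ F V]
  {F' : Type*} [NormedAddCommGroup F'] [NormedSpace ℝ F']
  {W : M → Type*} [TopologicalSpace (TotalSpace F' W)]
  [∀ x, TopologicalSpace (W x)] [∀ x, AddCommGroup (W x)] [∀ x, Module ℝ (W x)]
  [FiberBundle F' W] [VectorBundle ℝ F' W]
  (B : Sec I F V →ₗ[Smooth I M] Sec I F' W →ₗ[Smooth I M] Smooth I M)

/-- The space of multisections of `V` of degree `p`. -/
abbrev Multisec (_B : Sec I F V →ₗ[Smooth I M] Sec I F' W →ₗ[Smooth I M] Smooth I M) (p : ℕ) :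
    Type _ := Sec I F' W [⋀^Fin p]→ₗ[Smooth I M] Smooth I M

/-- A section of `V` as a multisection of degree one. -/
def ofSec (X : Sec I F V) : Cochain I F' W 1 := fun ξ => B X (ξ 0)

variable (A : LieAlgebroid I F V)

/-- The functional `Y ↦ ρ(X)⟨Y, ξ⟩ - ⟨[X, Y], ξ⟩` on `Γ(V)`. -/
def lieDualAux (X : Sec I F V) (ξ : Sec I F' W) : Module.Dual (Smooth I M) (Sec I F V) where
  toFun Y := A.deriv X (B Y ξ) - B (A.bracket X Y) ξ
  map_add' Y Z := by
    simp only [map_add, LinearMap.add_apply, A.deriv_add]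
    abel
  map_smul' f Y := by
    simp only [A.leibniz, map_add, map_smul, LinearMap.add_apply, LinearMap.smul_apply,
      smul_eq_mul, A.deriv_mul, RingHom.id_apply]
    ring

variable [B.IsPerfPair]

/-- The Lie derivative `L_X ξ ∈ Γ(W)` of `ξ ∈ Γ(W)` along `X ∈ Γ(V)`, defined by
`⟨Y, L_X ξ⟩ = ρ(X)⟨Y, ξ⟩ - ⟨[X, Y], ξ⟩` for all `Y ∈ Γ(V)`. -/
def lieDual (X : Sec I F V) (ξ : Sec I F' W) : Sec I F' W :=
  B.flip.toPerfPair.symm (lieDualAux B A X ξ)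

/-- The generalized Schouten bracket `[X, P] = L_X P` of a section and a multisection of `V`,
`[X, P](ξ₁, …, ξ_p) = ρ(X)(P(ξ₁, …, ξ_p)) - ∑ i, P(ξ₁, …, L_X ξ_i, …, ξ_p)`. -/
def schouten (X : Sec I F V) {p : ℕ} (P : Cochain I F' W p) : Cochain I F' W p :=
  fun ξ => A.deriv X (P ξ) - ∑ i, P (Function.update ξ i (lieDual B A X (ξ i)))

/-- The deformed Schouten bracket `[X, P]^φ = [X, P] - (p - 1) φ(X) P` of a section `X` and a
multisection `P` of degree `p`: the case `r = 1`, `s = p` of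
`[Q, P]^φ = [Q, P] + (r - 1) Q ∧ ι_φ P - (-1)^(r-1) (s - 1) ι_φ Q ∧ P`. -/
def schoutenDef (φ : Sec I F' W) (X : Sec I F V) {p : ℕ} (P : Cochain I F' W p) :
    Cochain I F' W p :=
  fun ξ => schouten B A X P ξ - ((p : ℝ) - 1) • (B X φ * P ξ)

/-- The deformed Schouten bracket `[P, Y]^φ = [P, Y] + (p - 1) φ(Y) P` of a multisection `P` of
degree `p` and a section `Y`, where `[P, Y] = -[Y, P]`: the case `r = p`, `s = 1` of the same
formula. -/
def schoutenDefRight (φ : Sec I F' W) {p : ℕ} (P : Cochain I F' W p) (Y : Sec I F V) :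
    Cochain I F' W p :=
  fun ξ => -schouten B A Y P ξ + ((p : ℝ) - 1) • (P ξ * B Y φ)

/-- `((A, φ₀), (A', X₀))` is a generalized Lie bialgebroid, where `A` and `A'` are Lie algebroid
structures on the bundles `V` and `W` in duality: `φ₀ ∈ Γ(W)` is a 1-cocycle of `A`, `X₀ ∈ Γ(V)`
is a 1-cocycle of `A'`, and, with `d_*^{X₀}` and `L_*^{X₀}` the deformed differential and Lie
derivative of `A'`,
* `d_*^{X₀}[X, Y] = [d_*^{X₀}X, Y]^{φ₀} + [X, d_*^{X₀}Y]^{φ₀}` for all `X, Y ∈ Γ(V)`;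
* `L_{*φ₀}^{X₀} P + [X₀, P]^{φ₀} = 0` for all multisections `P` of `V` of every degree. -/
structure IsGenLieBialgebroid (φ₀ : Sec I F' W) (A' : LieAlgebroid I F' W) (X₀ : Sec I F V) :
    Prop where
  cocycle : A.IsCocycle (fun X => B X φ₀)
  cocycle' : A'.IsCocycle (fun ξ => B X₀ ξ)
  compat : ∀ X Y : Sec I F V,
    A'.dDef (B X₀) (ofSec B (A.bracket X Y)) =
      schoutenDefRight B A φ₀ (A'.dDef (B X₀) (ofSec B X)) Y +
      schoutenDef B A φ₀ X (A'.dDef (B X₀) (ofSec B Y))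
  lie_add_lie : ∀ (p : ℕ) (P : Multisec B p),
    A'.lieDef (B X₀) φ₀ (P : Cochain I F' W p) + schoutenDef B A φ₀ X₀ P = 0

end Bialgebroid

end GenLieBialgebroid

end

open GenLieBialgebroid

/-!
The whole theorem takes place over the algebra `R = C^∞(M)`, with `Γ(V)` and `Γ(W)` two `R`-modules
in duality. Write `a_X` for `ρ(X)`, `b_ξ` for `ρ_*(ξ)` and `⟨·, ·⟩` for the pairing.

*The infinitesimal condition.* In degree zero it says `⟨X₀, φ₀⟩ = 0` and `b_{φ₀} = -a_{X₀}`, in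
degree one `[φ₀, ξ]_* = -L_{X₀} ξ`, equivalently `L_{*φ₀} Y = -[X₀, Y]`. By Cartan's formula
(`lieDef_apply`), applied to forms of `A`, these low degree cases give the exchanged condition in
every degree (`IsGenLieBialgebroid.lie_add_lie_flip`).

*The compatibility condition.* Let `E(X, Y; ξ, η)` be the difference of its two sides
(`compatDefect`), and `E*(ξ, η; X, Y)` the same expression for the exchanged pair. For arbitrary
pairs of Lie algebroids in duality, expansion gives (`compatDefect_sub_compatDefect_flip`)

  `E - E* = K(X, ξ)⟨Y, η⟩ - K(X, η)⟨Y, ξ⟩ - K(Y, ξ)⟨X, η⟩ + K(Y, η)⟨X, ξ⟩`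

with first order operators `K(X, ξ)` on `R` (`crossTerm`). On the other hand
`E(X, fY) - f E(X, Y) = G(X, f) ∧ Y` for a section `G(X, f)` of `V` (`leibnizDefect`,
`compatDefect_smul_right`), and `G(gX, f) - g G(X, f) = (b_{df} g + b_{dg} f) X`
(`leibnizDefect_smul`). Suppose `E = 0`. If the rank of `V` is at least two, then `G(X, f) ∧ Y = 0`
for all `Y` forces `G = 0`, hence `b_{df} g` is antisymmetric in `f` and `g`; since `K` and `G`
differ by explicit terms, the degree one condition above gives
`K(X, ξ)⟨Y, η⟩ + K(Y, η)⟨X, ξ⟩ = 0`, so that `E* = E = 0`. If the rank is at most one, nothing can be extracted from `E = 0`, but then `E*`, which is alternating and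
`R`-bilinear in `(X, Y)`, vanishes anyway (`alternating_eq_zero_of_finrank_le_one`).
-/

open Bundle Manifold
open scoped ContDiff

noncomputable section

set_option linter.unusedSectionVars false

namespace GenLieBialgebroid

/-! ### Derivations, brackets and Lie derivatives -/

section Calculus

variable {E : Type*} [NormedAddCommGroup E] [NormedSpace ℝ E]
  {H : Type*} [TopologicalSpace H] {I : ModelWithCorners ℝ E H}
  {M : Type*} [TopologicalSpace M] [ChartedSpace H M] [IsManifold I ∞ M]
  {F : Type*} [NormedAddCommGroup F] [NormedSpace ℝ F]
  {V : M → Type*} [TopologicalSpace (TotalSpace F V)]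
  [∀ x, TopologicalSpace (V x)] [∀ x, AddCommGroup (V x)] [∀ x, Module ℝ (V x)]
  [FiberBundle F V] [VectorBundle ℝ F V]
  {F' : Type*} [NormedAddCommGroup F'] [NormedSpace ℝ F']
  {W : M → Type*} [TopologicalSpace (TotalSpace F' W)]
  [∀ x, TopologicalSpace (W x)] [∀ x, AddCommGroup (W x)] [∀ x, Module ℝ (W x)]
  [FiberBundle F' W] [VectorBundle ℝ F' W]

theorem AnchorMap.deriv_add_left (ρ : AnchorMap I F V) (X Y : Sec I F V) (f : Smooth I M) :
    ρ.deriv (X + Y) f = ρ.deriv X f + ρ.deriv Y f := by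
  ext x
  change mfderiv I 𝓘(ℝ) f x (ρ.anchor x (X x + Y x)) = _
  rw [map_add, map_add]
  rfl

theorem AnchorMap.deriv_smul_left (ρ : AnchorMap I F V) (g : Smooth I M) (X : Sec I F V)
    (f : Smooth I M) : ρ.deriv (g • X) f = g * ρ.deriv X f := by
  ext x
  change mfderiv I 𝓘(ℝ) f x (ρ.anchor x (g x • X x)) = _
  rw [map_smul, map_smul]
  rfl

theorem AnchorMap.deriv_zero (ρ : AnchorMap I F V) (X : Sec I F V) :
    ρ.deriv X 0 = 0 := by
  simpa using ρ.deriv_add X 0 0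

theorem AnchorMap.deriv_one (ρ : AnchorMap I F V) (X : Sec I F V) :
    ρ.deriv X 1 = 0 := by
  simpa using ρ.deriv_mul X 1 1

theorem AnchorMap.deriv_neg (ρ : AnchorMap I F V) (X : Sec I F V) (f : Smooth I M) :
    ρ.deriv X (-f) = -ρ.deriv X f := by
  have h := ρ.deriv_add X (-f) f
  rw [neg_add_cancel, ρ.deriv_zero] at h
  exact eq_neg_of_add_eq_zero_left h.symm

theorem AnchorMap.deriv_sub (ρ : AnchorMap I F V) (X : Sec I F V) (f g : Smooth I M) :
    ρ.deriv X (f - g) = ρ.deriv X f - ρ.deriv X g := by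
  rw [sub_eq_add_neg, ρ.deriv_add, ρ.deriv_neg, sub_eq_add_neg]

theorem LieAlgebroid.bracket_swap (A : LieAlgebroid I F V) (X Y : Sec I F V) :
    A.bracket X Y = -A.bracket Y X := by
  have h := A.bracket_self (X + Y)
  simp only [map_add, LinearMap.add_apply, A.bracket_self, zero_add, add_zero] at h
  exact eq_neg_of_add_eq_zero_right h

theorem LieAlgebroid.smul_bracket (A : LieAlgebroid I F V) (f : Smooth I M) (X Y : Sec I F V) :
    A.bracket (f • X) Y = f • A.bracket X Y - A.deriv Y f • X := by
  rw [A.bracket_swap, A.leibniz, A.bracket_swap Y X, smul_neg]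
  abel

variable (B : Sec I F V →ₗ[Smooth I M] Sec I F' W →ₗ[Smooth I M] Smooth I M)
  (A : LieAlgebroid I F V)

variable {B} in
theorem ext_right_of_isPerfPair [B.IsPerfPair] {ξ η : Sec I F' W} (h : ∀ Y, B Y ξ = B Y η) :
    ξ = η :=
  (LinearMap.IsPerfPair.bijective_right B).1 (LinearMap.ext h)

@[simp] theorem apply_lieDual [B.IsPerfPair] (X Y : Sec I F V) (ξ : Sec I F' W) :
    B Y (lieDual B A X ξ) = A.deriv X (B Y ξ) - B (A.bracket X Y) ξ :=
  LinearMap.apply_toPerfPair_flip B _ Y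

/-- The differential `df ∈ Γ(W)` of a function, defined by `⟨X, df⟩ = ρ(X)f`. -/
def differential [B.IsPerfPair] (f : Smooth I M) : Sec I F' W :=
  B.flip.toPerfPair.symm
    { toFun := fun X => A.deriv X f
      map_add' := fun X Y => A.deriv_add_left X Y f
      map_smul' := fun g X => A.deriv_smul_left g X f }

@[simp] theorem apply_differential [B.IsPerfPair] (X : Sec I F V) (f : Smooth I M) :
    B X (differential B A f) = A.deriv X f :=
  LinearMap.apply_toPerfPair_flip B _ X

theorem lieDual_smul_left [B.IsPerfPair] (f : Smooth I M) (X : Sec I F V) (ξ : Sec I F' W) :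
    lieDual B A (f • X) ξ = f • lieDual B A X ξ + B X ξ • differential B A f := by
  refine ext_right_of_isPerfPair (B := B) fun Y => ?_
  simp only [apply_lieDual, map_add, map_smul, apply_differential, A.smul_bracket, map_sub,
    LinearMap.sub_apply, LinearMap.smul_apply, A.deriv_smul_left, smul_eq_mul]
  ring

theorem lieDual_smul_right [B.IsPerfPair] (f : Smooth I M) (X : Sec I F V) (ξ : Sec I F' W) :
    lieDual B A X (f • ξ) = f • lieDual B A X ξ + A.deriv X f • ξ := by
  refine ext_right_of_isPerfPair (B := B) fun Y => ?_
  simp only [apply_lieDual, map_add, map_smul, A.deriv_mul, smul_eq_mul]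
  ring

theorem lieDual_add_right [B.IsPerfPair] (X : Sec I F V) (ξ η : Sec I F' W) :
    lieDual B A X (ξ + η) = lieDual B A X ξ + lieDual B A X η := by
  refine ext_right_of_isPerfPair (B := B) fun Z => ?_
  simp only [apply_lieDual, map_add, A.deriv_add]
  ring

/-! ### The compatibility condition as a scalar identity -/

variable (A' : LieAlgebroid I F' W)

/-- The values `(d_*^{X₀}Z)(ξ, η)` of the deformed differential of a section `Z` of `V`. -/
def dSec (X₀ Z : Sec I F V) (ξ η : Sec I F' W) : Smooth I M :=
  A'.deriv ξ (B Z η) - A'.deriv η (B Z ξ) - B Z (A'.bracket ξ η)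
    + B X₀ ξ * B Z η - B X₀ η * B Z ξ

theorem dDef_ofSec_apply (X₀ Z : Sec I F V) (ξ : Fin 2 → Sec I F' W) :
    A'.dDef (B X₀) (ofSec B Z) ξ = dSec B A' X₀ Z (ξ 0) (ξ 1) := by
  have h1 : Finset.Ici (0 : Fin 1) = {0} := rfl
  simp [LieAlgebroid.dDef, LieAlgebroid.d, wedgeOne, ofSec, dSec, Fin.sum_univ_two,
    Fin.removeNth_apply, h1]
  ring

/-- The difference of the two sides of the compatibility condition
`d_*^{X₀}[X, Y] = [d_*^{X₀}X, Y]^φ + [X, d_*^{X₀}Y]^φ`, evaluated on `(ξ, η)`. -/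
def compatDefect [B.IsPerfPair] (φ : Sec I F' W) (X₀ X Y : Sec I F V) (ξ η : Sec I F' W) :
    Smooth I M :=
  dSec B A' X₀ (A.bracket X Y) ξ η
    + (A.deriv Y (dSec B A' X₀ X ξ η) - dSec B A' X₀ X (lieDual B A Y ξ) η
      - dSec B A' X₀ X ξ (lieDual B A Y η)) - B Y φ * dSec B A' X₀ X ξ η
    - (A.deriv X (dSec B A' X₀ Y ξ η) - dSec B A' X₀ Y (lieDual B A X ξ) η
      - dSec B A' X₀ Y ξ (lieDual B A X η)) + B X φ * dSec B A' X₀ Y ξ η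

theorem compat_iff_compatDefect_eq_zero [B.IsPerfPair] (φ : Sec I F' W) (X₀ X Y : Sec I F V) :
    A'.dDef (B X₀) (ofSec B (A.bracket X Y)) =
      schoutenDefRight B A φ (A'.dDef (B X₀) (ofSec B X)) Y +
      schoutenDef B A φ X (A'.dDef (B X₀) (ofSec B Y)) ↔
    ∀ ξ η, compatDefect B A A' φ X₀ X Y ξ η = 0 := by
  have key (ξ : Fin 2 → Sec I F' W) :
      A'.dDef (B X₀) (ofSec B (A.bracket X Y)) ξ -
      (schoutenDefRight B A φ (A'.dDef (B X₀) (ofSec B X)) Y +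
      schoutenDef B A φ X (A'.dDef (B X₀) (ofSec B Y))) ξ =
      compatDefect B A A' φ X₀ X Y (ξ 0) (ξ 1) := by
    have h2 : ((1 + 1 : ℕ) : ℝ) - 1 = 1 := by norm_num
    have h3 (f : Fin (1 + 1) → Smooth I M) : ∑ i, f i = f 0 + f 1 := Fin.sum_univ_two f
    simp only [Pi.add_apply, schoutenDefRight, schoutenDef, schouten, dDef_ofSec_apply,
      h3, Function.update_self, compatDefect, h2, one_smul,
      Function.update_of_ne (show (1 : Fin 2) ≠ 0 by decide),
      Function.update_of_ne (show (0 : Fin 2) ≠ 1 by decide)]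
    ring
  constructor
  · intro h ξ η
    have := key ![ξ, η]
    rw [h, sub_self] at this
    exact this.symm
  · intro h
    funext ξ
    rw [← sub_eq_zero, key, h]

end Calculus

/-! ### Exchanging the two Lie algebroids -/

section Exchange

variable {E : Type*} [NormedAddCommGroup E] [NormedSpace ℝ E]
  {H : Type*} [TopologicalSpace H] {I : ModelWithCorners ℝ E H}
  {M : Type*} [TopologicalSpace M] [ChartedSpace H M] [IsManifold I ∞ M]
  {F : Type*} [NormedAddCommGroup F] [NormedSpace ℝ F]
  {V : M → Type*} [TopologicalSpace (TotalSpace F V)]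
  [∀ x, TopologicalSpace (V x)] [∀ x, AddCommGroup (V x)] [∀ x, Module ℝ (V x)]
  [FiberBundle F V] [VectorBundle ℝ F V]
  {F' : Type*} [NormedAddCommGroup F'] [NormedSpace ℝ F']
  {W : M → Type*} [TopologicalSpace (TotalSpace F' W)]
  [∀ x, TopologicalSpace (W x)] [∀ x, AddCommGroup (W x)] [∀ x, Module ℝ (W x)]
  [FiberBundle F' W] [VectorBundle ℝ F' W]

variable (B : Sec I F V →ₗ[Smooth I M] Sec I F' W →ₗ[Smooth I M] Smooth I M)
  (A : LieAlgebroid I F V) (A' : LieAlgebroid I F' W)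

/-- Evaluation of `⟨L_{*η} Y, L_X ξ⟩` through either Lie derivative. -/
theorem pairing_bracket_lieDual [B.IsPerfPair] (X Y : Sec I F V) (ξ η : Sec I F' W) :
    B Y (A'.bracket (lieDual B A X ξ) η) =
      B (A.bracket (lieDual B.flip A' η Y) X) ξ
      - A'.deriv η (B Y (lieDual B A X ξ)) + A.deriv X (B (lieDual B.flip A' η Y) ξ) := by
  have h1 := apply_lieDual B A X (lieDual B.flip A' η Y) ξ
  have h2 := apply_lieDual B.flip A' η (lieDual B A X ξ) Y
  rw [LinearMap.flip_apply] at h2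
  rw [h1] at h2
  rw [A'.bracket_swap, A.bracket_swap, map_neg, map_neg, LinearMap.neg_apply]
  simp only [LinearMap.flip_apply] at h2
  linear_combination -h2

/-- A first order operator on functions, attached to `X ∈ Γ(V)` and `ξ ∈ Γ(W)`, which measures
how far apart the compatibility defects of a pair of Lie algebroids and of the exchanged pair
are. -/
def crossTerm [B.IsPerfPair] (φ : Sec I F' W) (X₀ X : Sec I F V) (ξ : Sec I F' W)
    (f : Smooth I M) : Smooth I M :=
  A'.deriv ξ (A.deriv X f) - A.deriv X (A'.deriv ξ f) + A'.deriv (lieDual B A X ξ) f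
    - A.deriv (lieDual B.flip A' ξ X) f + B X φ * A'.deriv ξ f - B X₀ ξ * A.deriv X f
    + (B (A.bracket X₀ X) ξ - B X (A'.bracket φ ξ)) * f

theorem compatDefect_sub_compatDefect_flip [B.IsPerfPair] (φ : Sec I F' W) (X₀ X Y : Sec I F V)
    (ξ η : Sec I F' W) :
    compatDefect B A A' φ X₀ X Y ξ η - compatDefect B.flip A' A X₀ φ ξ η X Y =
      crossTerm B A A' φ X₀ X ξ (B Y η) - crossTerm B A A' φ X₀ X η (B Y ξ)
      - crossTerm B A A' φ X₀ Y ξ (B X η) + crossTerm B A A' φ X₀ Y η (B X ξ) := by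
  have h1 := pairing_bracket_lieDual B A A' X Y ξ η
  have h2 := pairing_bracket_lieDual B A A' X Y η ξ
  have h3 := pairing_bracket_lieDual B A A' Y X ξ η
  have h4 := pairing_bracket_lieDual B A A' Y X η ξ
  have e1 := A'.bracket_swap ξ (lieDual B A X η)
  have e2 := A'.bracket_swap ξ (lieDual B A Y η)
  have e3 := A.bracket_swap X (lieDual B.flip A' η Y)
  have e4 := A.bracket_swap X (lieDual B.flip A' ξ Y)
  have e5 := A'.bracket_swap ξ φ
  have e6 := A'.bracket_swap η φ
  have e7 := A.bracket_swap X X₀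
  have e8 := A.bracket_swap Y X₀
  have e9 := A.bracket_swap Y X
  have e10 := A'.bracket_swap η ξ
  have k (X : Sec I F V) (ξ η : Sec I F' W) := apply_lieDual B.flip A' ξ η X
  simp only [LinearMap.flip_apply] at k
  simp only [compatDefect, dSec, crossTerm, LinearMap.flip_apply, e1, e2, e3, e4, map_neg,
    h1, h2, h3, h4]
  simp only [apply_lieDual, k, A.deriv_add, A.deriv_sub, A.deriv_mul, A'.deriv_add, A'.deriv_sub,
    A'.deriv_mul, e5, e6, e7, e8, e9, e10, map_neg, LinearMap.neg_apply, A.deriv_neg, A'.deriv_neg]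
  ring

/-- The failure of the compatibility defect to be `C^∞(M)`-linear in its second section, see
`compatDefect_smul_right`. -/
def leibnizDefect [B.IsPerfPair] (φ : Sec I F' W) (X₀ X : Sec I F V) (f : Smooth I M)
    (ξ : Sec I F' W) : Smooth I M :=
  A'.deriv ξ (A.deriv X f) - A.deriv X (A'.deriv ξ f) + A'.deriv (lieDual B A X ξ) f
    - A.deriv (lieDual B.flip A' ξ X) f + B X φ * A'.deriv ξ f - B X₀ ξ * A.deriv X f
    + A'.deriv (differential B A f) (B X ξ) + A.deriv X₀ f * B X ξ

theorem pairing_bracket_differential [B.IsPerfPair] (f : Smooth I M) (X : Sec I F V)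
    (ξ : Sec I F' W) :
    B X (A'.bracket ξ (differential B A f)) =
      A'.deriv ξ (A.deriv X f) - A.deriv (lieDual B.flip A' ξ X) f := by
  have h := apply_lieDual B.flip A' ξ (differential B A f) X
  simp only [LinearMap.flip_apply, apply_differential] at h
  rw [h]
  ring

theorem compatDefect_smul_right [B.IsPerfPair] (φ : Sec I F' W) (X₀ X Y : Sec I F V)
    (f : Smooth I M) (ξ η : Sec I F' W) :
    compatDefect B A A' φ X₀ X (f • Y) ξ η = f * compatDefect B A A' φ X₀ X Y ξ η
      + leibnizDefect B A A' φ X₀ X f ξ * B Y η - leibnizDefect B A A' φ X₀ X f η * B Y ξ := by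
  have e1 := A'.bracket_swap (differential B A f) η
  have e2 := A.bracket_swap Y X₀
  have e3 := A.bracket_swap X X₀
  simp only [compatDefect, dSec, leibnizDefect, A.leibniz, lieDual_smul_left, A.deriv_smul_left,
    A'.deriv_smul_left, A'.deriv_add_left, map_add, LinearMap.add_apply, map_smul, A'.smul_bracket,
    A'.leibniz, map_sub, LinearMap.smul_apply, smul_eq_mul, apply_differential, e1, map_neg,
    pairing_bracket_differential, A.deriv_add, A.deriv_sub, A.deriv_mul,
    A'.deriv_add, A'.deriv_sub, A'.deriv_mul, apply_lieDual, e2, e3,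
    LinearMap.neg_apply]
  ring

theorem leibnizDefect_smul [B.IsPerfPair] (φ : Sec I F' W) (X₀ X : Sec I F V)
    (f g : Smooth I M) (ξ : Sec I F' W) :
    leibnizDefect B A A' φ X₀ (g • X) f ξ = g * leibnizDefect B A A' φ X₀ X f ξ
      + (A'.deriv (differential B A f) g + A'.deriv (differential B A g) f) * B X ξ := by
  simp only [leibnizDefect, lieDual_smul_left, lieDual_smul_right, A.deriv_smul_left,
    A.deriv_add_left, A'.deriv_smul_left, A'.deriv_add_left, map_smul, LinearMap.smul_apply,
    smul_eq_mul, A'.deriv_mul]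
  ring

/-- If the Leibniz defects vanish and `⟨df, d_*g⟩` is antisymmetric in `f` and `g`, the cross
terms are antisymmetric under exchange of `(X, ξ)` and `(Y, η)`. -/
theorem crossTerm_add_crossTerm_eq_zero [B.IsPerfPair] (φ : Sec I F' W) (X₀ X Y : Sec I F V)
    (ξ η : Sec I F' W)
    (hdual : ∀ Z ζ, B (A.bracket X₀ Z) ζ - B Z (A'.bracket φ ζ) = A.deriv X₀ (B Z ζ))
    (hskew : ∀ f g, A'.deriv (differential B A f) g + A'.deriv (differential B A g) f = 0)
    (h : ∀ Z f ζ, leibnizDefect B A A' φ X₀ Z f ζ = 0) :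
    crossTerm B A A' φ X₀ X ξ (B Y η) + crossTerm B A A' φ X₀ Y η (B X ξ) = 0 := by
  have h1 := h X (B Y η) ξ
  have h2 := h Y (B X ξ) η
  have h3 := hskew (B Y η) (B X ξ)
  simp only [leibnizDefect] at h1 h2
  simp only [crossTerm, hdual]
  linear_combination h1 + h2 - h3

end Exchange

/-! ### Multilinearity of the compatibility defect -/

section Tensorial

variable {E : Type*} [NormedAddCommGroup E] [NormedSpace ℝ E]
  {H : Type*} [TopologicalSpace H] {I : ModelWithCorners ℝ E H}
  {M : Type*} [TopologicalSpace M] [ChartedSpace H M] [IsManifold I ∞ M]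
  {F : Type*} [NormedAddCommGroup F] [NormedSpace ℝ F]
  {V : M → Type*} [TopologicalSpace (TotalSpace F V)]
  [∀ x, TopologicalSpace (V x)] [∀ x, AddCommGroup (V x)] [∀ x, Module ℝ (V x)]
  [FiberBundle F V] [VectorBundle ℝ F V]
  {F' : Type*} [NormedAddCommGroup F'] [NormedSpace ℝ F']
  {W : M → Type*} [TopologicalSpace (TotalSpace F' W)]
  [∀ x, TopologicalSpace (W x)] [∀ x, AddCommGroup (W x)] [∀ x, Module ℝ (W x)]
  [FiberBundle F' W] [VectorBundle ℝ F' W]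

variable (B : Sec I F V →ₗ[Smooth I M] Sec I F' W →ₗ[Smooth I M] Smooth I M)
  (A : LieAlgebroid I F V) (A' : LieAlgebroid I F' W)

theorem dSec_add_left (X₀ Z : Sec I F V) (ξ ξ' η : Sec I F' W) :
    dSec B A' X₀ Z (ξ + ξ') η = dSec B A' X₀ Z ξ η + dSec B A' X₀ Z ξ' η := by
  simp only [dSec, A'.deriv_add_left, A'.deriv_add, map_add, LinearMap.add_apply]
  ring

theorem dSec_smul_left (X₀ Z : Sec I F V) (f : Smooth I M) (ξ η : Sec I F' W) :
    dSec B A' X₀ Z (f • ξ) η = f * dSec B A' X₀ Z ξ η := by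
  simp only [dSec, A'.deriv_smul_left, A'.deriv_mul, map_smul, smul_eq_mul, A'.smul_bracket,
    map_sub]
  ring

theorem dSec_swap (X₀ Z : Sec I F V) (ξ η : Sec I F' W) :
    dSec B A' X₀ Z ξ η = -dSec B A' X₀ Z η ξ := by
  simp only [dSec, A'.bracket_swap ξ η, map_neg]
  ring

theorem compatDefect_swap [B.IsPerfPair] (φ : Sec I F' W) (X₀ X Y : Sec I F V)
    (ξ η : Sec I F' W) :
    compatDefect B A A' φ X₀ X Y ξ η = -compatDefect B A A' φ X₀ X Y η ξ := by
  simp only [compatDefect, dSec_swap B A' _ _ _ η, dSec_swap B A' _ _ _ (lieDual B A _ η),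
    A.deriv_neg]
  ring

/-- The compatibility defect of `X` and `Y` evaluated on `(ξ, η)`, as a `C^∞(M)`-linear function
of `ξ`. -/
def compatDefectLinear [B.IsPerfPair] (φ : Sec I F' W) (X₀ X Y : Sec I F V) (η : Sec I F' W) :
    Module.Dual (Smooth I M) (Sec I F' W) where
  toFun ξ := compatDefect B A A' φ X₀ X Y ξ η
  map_add' ξ ξ' := by
    simp only [compatDefect, dSec_add_left, lieDual_add_right, A.deriv_add]
    ring
  map_smul' f ξ := by
    simp only [compatDefect, dSec_smul_left, dSec_add_left, lieDual_smul_right, A.deriv_mul,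
      RingHom.id_apply, smul_eq_mul]
    ring

end Tensorial

/-! ### Pointwise arguments -/

section Pointwise

variable {E : Type*} [NormedAddCommGroup E] [NormedSpace ℝ E] [FiniteDimensional ℝ E]
  {H : Type*} [TopologicalSpace H] {I : ModelWithCorners ℝ E H}
  {M : Type*} [TopologicalSpace M] [ChartedSpace H M] [IsManifold I ∞ M] [T2Space M]
  {F : Type*} [NormedAddCommGroup F] [NormedSpace ℝ F] [FiniteDimensional ℝ F]
  {V : M → Type*} [TopologicalSpace (TotalSpace F V)]
  [∀ x, TopologicalSpace (V x)] [∀ x, AddCommGroup (V x)] [∀ x, Module ℝ (V x)]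
  [FiberBundle F V] [VectorBundle ℝ F V] [ContMDiffVectorBundle ∞ F V I]

theorem Sec.sum_apply {ι : Type*} (s : Finset ι) (X : ι → Sec I F V) (x : M) :
    (∑ i ∈ s, X i) x = ∑ i ∈ s, X i x := by
  rw [← ContMDiffSection.coeAddHom_apply, map_sum, Finset.sum_apply]
  rfl

theorem Smooth.sum_apply {ι : Type*} (s : Finset ι) (f : ι → Smooth I M) (x : M) :
    (∑ i ∈ s, f i) x = ∑ i ∈ s, f i x :=
  map_sum (ContMDiffMap.evalRingHom (I := I) x) f s

variable (I F) in
theorem exists_section_eq (x : M) (v : V x) : ∃ X : Sec I F V, X x = v := by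
  obtain ⟨n, e, ε, ψ, h1, h⟩ := exists_local_dual_basis (I := I) (F := F) (V := V) x
  refine ⟨∑ i, (ε i x v : ℝ) • e i, ?_⟩
  rw [Sec.sum_apply]
  simpa [h1] using (h x v).symm

variable (I F) in
theorem exists_dual_section_ne_zero {x : M} {v : V x} (hv : v ≠ 0) :
    ∃ ξ : Sec I (F →L[ℝ] ℝ) (DualBundle V), (ξ x v : ℝ) ≠ 0 := by
  obtain ⟨n, e, ε, ψ, h1, h⟩ := exists_local_dual_basis (I := I) (F := F) (V := V) x
  by_contra! h0
  have := h x v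
  simp only [h0, zero_smul, Finset.sum_const_zero, h1, one_smul] at this
  exact hv this

/-- A `C^∞(M)`-linear functional on sections is local at points. -/
theorem dual_apply_eq_zero_of_apply_eq_zero (T : Module.Dual (Smooth I M) (Sec I F V))
    {Z : Sec I F V} {x : M} (hZ : Z x = 0) : T Z x = 0 := by
  obtain ⟨n, e, ε, ψ, h1, h⟩ := exists_local_dual_basis (I := I) (F := F) (V := V) x
  have key : ψ • Z = ∑ i, dualPairing I F V Z (ε i) • e i := by
    ext y
    rw [smul_apply, h y (Z y), Sec.sum_apply]
    rfl
  have h2 := congrArg (fun f : Smooth I M => f x) (congrArg T key)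
  simp only [map_sum, map_smul, Smooth.sum_apply] at h2
  have h3 : ψ x * T Z x = ∑ i, dualPairing I F V Z (ε i) x * T (e i) x := h2
  simpa [h1, hZ] using h3

variable (F V) in
/-- The linear isomorphism of a fibre with the model fibre given by the preferred trivialization. -/
def fiberEquiv (x : M) : V x ≃L[ℝ] F :=
  (trivializationAt F V x).continuousLinearEquivAt ℝ x
    (FiberBundle.mem_baseSet_trivializationAt F V x)

variable (F V) in
theorem finrank_fiber (x : M) : Module.finrank ℝ (V x) = Module.finrank ℝ F :=
  (fiberEquiv F V x).toLinearEquiv.finrank_eq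

/-- On a vector bundle of rank at most one every alternating bilinear form vanishes. -/
theorem alternating_eq_zero_of_finrank_le_one (hF : Module.finrank ℝ F ≤ 1)
    (Ω : Sec I F V → Module.Dual (Smooth I M) (Sec I F V)) (hΩ : ∀ X Y, Ω X Y = -Ω Y X)
    (X Y : Sec I F V) : Ω X Y = 0 := by
  ext x
  change Ω X Y x = 0
  have hfin : FiniteDimensional ℝ (V x) :=
    (fiberEquiv F V x).symm.toLinearEquiv.finiteDimensional
  have hself (Z : Sec I F V) : Ω Z Z x = 0 := by
    have : Ω Z Z x = -Ω Z Z x := congrArg (fun f : Smooth I M => f x) (hΩ Z Z)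
    linarith
  obtain ⟨v, hv⟩ := (finrank_le_one_iff (K := ℝ) (V := V x)).1 (by rwa [finrank_fiber F V x])
  obtain ⟨Z, hZ⟩ := exists_section_eq I F x v
  -- Both `Ω X` and `Ω · Y` only see the values at `x`, which are multiples of `Z x`.
  have key (T : Module.Dual (Smooth I M) (Sec I F V)) (U : Sec I F V) (hT : T Z x = 0) :
      T U x = 0 := by
    obtain ⟨c, hc⟩ := hv (U x)
    have h0 := dual_apply_eq_zero_of_apply_eq_zero T
      (Z := U - algebraMap ℝ (Smooth I M) c • Z) (x := x)
      (by
        change U x - c • Z x = 0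
        rw [hZ, hc, sub_self])
    rw [map_sub, map_smul] at h0
    have h1 : T U x - c * T Z x = 0 := h0
    rwa [hT, mul_zero, sub_zero] at h1
  have hswap (X Y : Sec I F V) : Ω X Y x = -Ω Y X x :=
    congrArg (fun f : Smooth I M => f x) (hΩ X Y)
  refine key _ _ ?_
  rw [hswap, key _ X (hself Z), neg_zero]

/-- On a vector bundle of rank at least two, a section whose wedge product with every section
vanishes is zero. -/
theorem eq_zero_of_wedge_eq_zero (hF : 2 ≤ Module.finrank ℝ F)
    (γ : Sec I (F →L[ℝ] ℝ) (DualBundle V) → Smooth I M)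
    (hγ : ∀ Y ξ η, γ ξ * dualPairing I F V Y η = γ η * dualPairing I F V Y ξ)
    (ξ : Sec I (F →L[ℝ] ℝ) (DualBundle V)) : γ ξ = 0 := by
  ext x
  have hker : ∃ v : V x, v ≠ 0 ∧ (ξ x v : ℝ) = 0 := by
    have hfin : FiniteDimensional ℝ (V x) :=
      (fiberEquiv F V x).symm.toLinearEquiv.finiteDimensional
    have := LinearMap.ker_ne_bot_of_finrank_lt (K := ℝ) (f := ((ξ x : V x →L[ℝ] ℝ) : V x →ₗ[ℝ] ℝ))
      (by rw [finrank_fiber F V x]; exact (Module.finrank_self ℝ).trans_lt hF)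
    obtain ⟨v, hv, hv0⟩ := (Submodule.ne_bot_iff _).1 this
    exact ⟨v, hv0, hv⟩
  obtain ⟨v, hv0, hv⟩ := hker
  obtain ⟨Y, hY⟩ := exists_section_eq I F x v
  obtain ⟨η, hη⟩ := exists_dual_section_ne_zero I F hv0
  have h : γ ξ x * η x (Y x) = γ η x * ξ x (Y x) :=
    congrArg (fun f : Smooth I M => f x) (hγ Y ξ η)
  rw [hY, hv, mul_zero] at h
  exact (mul_eq_zero.1 h).resolve_right hη

end Pointwise

/-! ### Cartan's formula -/

section CartanFormula

variable {E : Type*} [NormedAddCommGroup E] [NormedSpace ℝ E]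
  {H : Type*} [TopologicalSpace H] {I : ModelWithCorners ℝ E H}
  {M : Type*} [TopologicalSpace M] [ChartedSpace H M] [IsManifold I ∞ M]
  {F : Type*} [NormedAddCommGroup F] [NormedSpace ℝ F]
  {V : M → Type*} [TopologicalSpace (TotalSpace F V)]
  [∀ x, TopologicalSpace (V x)] [∀ x, AddCommGroup (V x)] [∀ x, Module ℝ (V x)]
  [FiberBundle F V] [VectorBundle ℝ F V]

variable (A : LieAlgebroid I F V)

theorem succ_removeNth_cons {β : Type*} {p : ℕ} (i : Fin (p + 1)) (X : β) (Y : Fin (p + 1) → β) :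
    i.succ.removeNth (Fin.cons X Y : Fin (p + 2) → β) = Fin.cons X (i.removeNth Y) := by
  funext j
  refine Fin.cases ?_ (fun j => ?_) j <;> simp [Fin.removeNth_apply]

theorem wedgeOne_cons (φ : Sec I F V → Smooth I M) {p : ℕ} (α : Cochain I F V (p + 1))
    (X : Sec I F V) (Y : Fin (p + 1) → Sec I F V) :
    wedgeOne φ α (Fin.cons X Y) = φ X * α Y - wedgeOne φ (contract X α) Y := by
  simp only [wedgeOne, contract]
  rw [Fin.sum_univ_succ]
  simp [pow_succ, succ_removeNth_cons, sub_eq_add_neg]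

theorem cons_removeNth_eq_update {p : ℕ}
    (α : Sec I F V [⋀^Fin (p + 1)]→ₗ[Smooth I M] Smooth I M)
    (j : Fin (p + 1)) (Y : Fin (p + 1) → Sec I F V) (Z : Sec I F V) :
    (-1 : ℝ) ^ (j : ℕ) • α (Fin.cons Z (j.removeNth Y)) = α (Function.update Y j Z) := by
  have h := α.map_insertNth j Z (j.removeNth Y)
  rw [Fin.insertNth_removeNth] at h
  rw [h]
  change _ = (-1 : ℤ) ^ (j : ℕ) • α (Fin.cons Z (j.removeNth Y))
  obtain h | h := neg_one_pow_eq_or ℤ (j : ℕ)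
  all_goals
    have h' : (-1 : ℝ) ^ (j : ℕ) = ((-1 : ℤ) ^ (j : ℕ) : ℤ) := by push_cast; rfl
    rw [h', h]
    simp

theorem map_cons_cons_swap {p : ℕ} (α : Sec I F V [⋀^Fin (p + 2)]→ₗ[Smooth I M] Smooth I M)
    (X Z : Sec I F V) (Y : Fin p → Sec I F V) :
    α (Fin.cons X (Fin.cons Z Y)) = -α (Fin.cons Z (Fin.cons X Y)) := by
  rw [← α.map_swap _ (show (0 : Fin (p + 2)) ≠ 1 by simp)]
  congr 1
  funext i
  refine Fin.cases ?_ (fun i => Fin.cases ?_ (fun i => ?_) i) i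
  · simp
  · simp
  · have h : Equiv.swap (0 : Fin (p + 2)) 1 i.succ.succ = i.succ.succ :=
      Equiv.swap_apply_of_ne_of_ne (Fin.succ_ne_zero _)
        (by rw [← Fin.succ_zero_eq_one]; exact fun h => Fin.succ_ne_zero _ (Fin.succ_injective _ h))
    simp [h]

theorem sum_deriv_cons {p : ℕ} (α : Cochain I F V (p + 1)) (X : Sec I F V)
    (Y : Fin (p + 1) → Sec I F V) :
    ∑ i : Fin (p + 2), (-1 : ℝ) ^ (i : ℕ) •
        A.deriv ((Fin.cons X Y : Fin (p + 2) → Sec I F V) i)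
          (α (i.removeNth (Fin.cons X Y : Fin (p + 2) → Sec I F V))) =
      A.deriv X (α Y) -
        ∑ i : Fin (p + 1), (-1 : ℝ) ^ (i : ℕ) • A.deriv (Y i) (α (Fin.cons X (i.removeNth Y))) := by
  rw [Fin.sum_univ_succ]
  simp [pow_succ, succ_removeNth_cons, sub_eq_add_neg]

/-- The bracket terms of `dα(X, Y₀, …)`: those with a bracket `[X, Y_j]`, from the index `i = 0`, and
those with a bracket `[Y_i, Y_{j+1}]`. -/
theorem sum_bracket_cons {p : ℕ} (α : Cochain I F V (p + 2)) (X : Sec I F V)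
    (Y : Fin (p + 2) → Sec I F V) :
    ∑ i : Fin (p + 2), ∑ j ∈ Finset.Ici i, (-1 : ℝ) ^ ((i : ℕ) + (j + 1 : ℕ)) •
        α (Fin.cons (A.bracket ((Fin.cons X Y : Fin (p + 3) → Sec I F V) i.castSucc)
          ((Fin.cons X Y : Fin (p + 3) → Sec I F V) j.succ))
          (i.removeNth (j.succ.removeNth (Fin.cons X Y : Fin (p + 3) → Sec I F V)))) =
      -∑ j : Fin (p + 2), (-1 : ℝ) ^ (j : ℕ) • α (Fin.cons (A.bracket X (Y j)) (j.removeNth Y)) +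
      ∑ i : Fin (p + 1), ∑ j ∈ Finset.Ici i, (-1 : ℝ) ^ ((i : ℕ) + (j + 1 : ℕ)) •
        α (Fin.cons (A.bracket (Y i.castSucc) (Y j.succ))
          (Fin.cons X (i.removeNth (j.succ.removeNth Y)))) := by
  have hI {n : ℕ} (i : Fin n) (f : Fin n → Smooth I M) :
      ∑ j ∈ Finset.Ici i, f j = ∑ j, if i ≤ j then f j else 0 := by
    rw [← Finset.sum_filter]
    congr 1
    ext j
    simp
  simp only [hI]
  rw [Fin.sum_univ_succ]
  congr 1
  · simp [pow_succ, succ_removeNth_cons]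
  · refine Finset.sum_congr rfl fun i _ => ?_
    rw [Fin.sum_univ_succ]
    simp [succ_removeNth_cons]
    refine Finset.sum_congr rfl fun j _ => ?_
    rw [show (i : ℕ) + 1 + (j + 1 + 1) = i + (j + 1) + 2 by ring, pow_add _ _ 2]
    simp

theorem contract_dDef_apply (φ : Sec I F V → Smooth I M) (X : Sec I F V) {p : ℕ}
    (α : Cochain I F V (p + 1)) (Y : Fin (p + 1) → Sec I F V) :
    contract X (A.dDef φ α) Y =
      A.d α (Fin.cons X Y) + (φ X * α Y - wedgeOne φ (contract X α) Y) :=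
  congrArg (A.d α (Fin.cons X Y) + ·) (wedgeOne_cons φ α X Y)

/-- Cartan's formula for the deformed Lie derivative of alternating forms. -/
theorem lieDef_apply (φ : Sec I F V → Smooth I M) (X : Sec I F V) {p : ℕ}
    (α : Sec I F V [⋀^Fin p]→ₗ[Smooth I M] Smooth I M) (Y : Fin p → Sec I F V) :
    A.lieDef φ X (α : Cochain I F V p) Y =
      A.deriv X (α Y) - ∑ i, α (Function.update Y i (A.bracket X (Y i))) + φ X * α Y := by
  match p with
  | 0 =>
    simp [LieAlgebroid.lieDef, contract, LieAlgebroid.dDef, LieAlgebroid.d, wedgeOne]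
  | 1 =>
    have h2 := cons_removeNth_eq_update α 0 Y (A.bracket X (Y 0))
    have h3 : Fin.tail (Fin.removeNth 1 (Fin.cons X Y : Fin 2 → Sec I F V)) = Fin.tail Y :=
      Subsingleton.elim _ _
    rw [LieAlgebroid.lieDef, Pi.add_apply, contract_dDef_apply]
    simp only [LieAlgebroid.dDef, LieAlgebroid.d, Pi.add_apply, sum_deriv_cons, contract]
    simp only [Fin.sum_univ_one, ← h2]
    simp [h3]
    ring
  | p + 2 =>
    have h2 (j) := cons_removeNth_eq_update α j Y (A.bracket X (Y j))
    rw [LieAlgebroid.lieDef, Pi.add_apply, contract_dDef_apply]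
    simp only [LieAlgebroid.dDef, LieAlgebroid.d, Pi.add_apply, sum_deriv_cons, sum_bracket_cons,
      h2, contract, map_cons_cons_swap α X, smul_neg, Finset.sum_neg_distrib]
    ring

end CartanFormula

/-! ### The infinitesimal condition -/

section Duality

variable {E : Type*} [NormedAddCommGroup E] [NormedSpace ℝ E]
  {H : Type*} [TopologicalSpace H] {I : ModelWithCorners ℝ E H}
  {M : Type*} [TopologicalSpace M] [ChartedSpace H M] [IsManifold I ∞ M]
  {F : Type*} [NormedAddCommGroup F] [NormedSpace ℝ F]
  {V : M → Type*} [TopologicalSpace (TotalSpace F V)]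
  [∀ x, TopologicalSpace (V x)] [∀ x, AddCommGroup (V x)] [∀ x, Module ℝ (V x)]
  [FiberBundle F V] [VectorBundle ℝ F V]
  {F' : Type*} [NormedAddCommGroup F'] [NormedSpace ℝ F']
  {W : M → Type*} [TopologicalSpace (TotalSpace F' W)]
  [∀ x, TopologicalSpace (W x)] [∀ x, AddCommGroup (W x)] [∀ x, Module ℝ (W x)]
  [FiberBundle F' W] [VectorBundle ℝ F' W]

variable {B : Sec I F V →ₗ[Smooth I M] Sec I F' W →ₗ[Smooth I M] Smooth I M} [B.IsPerfPair]
  {A : LieAlgebroid I F V} {A' : LieAlgebroid I F' W} {φ : Sec I F' W} {X₀ : Sec I F V}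

namespace IsGenLieBialgebroid

theorem lie_add_lie_apply (h : IsGenLieBialgebroid B A φ A' X₀) {p : ℕ} (P : Multisec B p)
    (ξ : Fin p → Sec I F' W) :
    A'.deriv φ (P ξ) - ∑ i, P (Function.update ξ i (A'.bracket φ (ξ i))) + B X₀ φ * P ξ
      + (A.deriv X₀ (P ξ) - ∑ i, P (Function.update ξ i (lieDual B A X₀ (ξ i)))
        - ((p : ℝ) - 1) • (B X₀ φ * P ξ)) = 0 := by
  rw [← lieDef_apply A' (B X₀) φ P ξ]
  exact congrFun (h.lie_add_lie p P) ξ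

theorem deriv_add_deriv (h : IsGenLieBialgebroid B A φ A' X₀) (f : Smooth I M) :
    A'.deriv φ f + A.deriv X₀ f + 2 * (B X₀ φ * f) = 0 := by
  have h0 := h.lie_add_lie_apply
    (AlternatingMap.constOfIsEmpty (Smooth I M) (Sec I F' W) (Fin 0) f) 0
  simp at h0
  linear_combination h0

/-- The section `X₀` pairs to zero with `φ₀`: the infinitesimal condition in degree zero, on the
constant function `1`. -/
theorem pairing_eq_zero (h : IsGenLieBialgebroid B A φ A' X₀) : B X₀ φ = 0 := by
  have h0 := h.deriv_add_deriv 1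
  simp only [A.deriv_one, A'.deriv_one, zero_add, mul_one, two_mul] at h0
  ext x
  have h1 : B X₀ φ x + B X₀ φ x = 0 := congrArg (fun f : Smooth I M => f x) h0
  change B X₀ φ x = 0
  linarith

theorem deriv_eq_neg (h : IsGenLieBialgebroid B A φ A' X₀) (f : Smooth I M) :
    A'.deriv φ f = -A.deriv X₀ f := by
  have h0 := h.deriv_add_deriv f
  rw [h.pairing_eq_zero] at h0
  linear_combination h0

/-- The infinitesimal condition in degree one: `[φ₀, ξ]_* = -L_{X₀} ξ`. -/
theorem pairing_bracket_sub (h : IsGenLieBialgebroid B A φ A' X₀) (Y : Sec I F V)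
    (ξ : Sec I F' W) :
    B (A.bracket X₀ Y) ξ - B Y (A'.bracket φ ξ) = A.deriv X₀ (B Y ξ) := by
  have h0 := h.lie_add_lie_apply
    (AlternatingMap.ofSubsingleton (Smooth I M) (Sec I F' W) (Smooth I M) (0 : Fin 1) (B Y))
    (fun _ => ξ)
  simp [h.pairing_eq_zero] at h0
  have h1 := h.deriv_eq_neg (B Y ξ)
  linear_combination h0 - h1

theorem lieDual_flip_eq (h : IsGenLieBialgebroid B A φ A' X₀) (Z : Sec I F V) :
    lieDual B.flip A' φ Z = -A.bracket X₀ Z := by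
  refine ext_right_of_isPerfPair (B := B.flip) fun ζ => ?_
  rw [apply_lieDual]
  simp only [LinearMap.flip_apply, map_neg]
  linear_combination h.deriv_eq_neg (B Z ζ) + h.pairing_bracket_sub Z ζ

/-- Cartan's formula and `L_{*φ₀} Z = -[X₀, Z]` reduce the exchanged infinitesimal condition to the
degree zero and one cases of the given one. -/
theorem lie_add_lie_flip (h : IsGenLieBialgebroid B A φ A' X₀) {p : ℕ} (Q : Multisec B.flip p) :
    A.lieDef (B.flip φ) X₀ (Q : Cochain I F V p) + schoutenDef B.flip A' X₀ φ Q = 0 := by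
  funext Y
  rw [Pi.add_apply, lieDef_apply]
  simp only [schoutenDef, schouten, h.lieDual_flip_eq, LinearMap.flip_apply, h.pairing_eq_zero,
    AlternatingMap.map_update_neg, Finset.sum_neg_distrib, h.deriv_eq_neg, zero_mul, smul_zero,
    Pi.zero_apply]
  ring

theorem compatDefect_eq_zero (h : IsGenLieBialgebroid B A φ A' X₀) (X Y : Sec I F V)
    (ξ η : Sec I F' W) : compatDefect B A A' φ X₀ X Y ξ η = 0 :=
  (compat_iff_compatDefect_eq_zero B A A' φ X₀ X Y).1 (h.compat X Y) ξ η

end IsGenLieBialgebroid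

end Duality

/-! ### The compatibility condition for the exchanged pair -/

section DualBundle

variable {E : Type*} [NormedAddCommGroup E] [NormedSpace ℝ E] [FiniteDimensional ℝ E]
  {H : Type*} [TopologicalSpace H] {I : ModelWithCorners ℝ E H}
  {M : Type*} [TopologicalSpace M] [ChartedSpace H M] [IsManifold I ∞ M] [T2Space M]
  {F : Type*} [NormedAddCommGroup F] [NormedSpace ℝ F] [FiniteDimensional ℝ F]
  {V : M → Type*} [TopologicalSpace (TotalSpace F V)]
  [∀ x, TopologicalSpace (V x)] [∀ x, AddCommGroup (V x)] [∀ x, Module ℝ (V x)]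
  [FiberBundle F V] [VectorBundle ℝ F V] [ContMDiffVectorBundle ∞ F V I]
  {A : LieAlgebroid I F V} {φ : Sec I (F →L[ℝ] ℝ) (DualBundle V)}
  {A' : LieAlgebroid I (F →L[ℝ] ℝ) (DualBundle V)} {X₀ : Sec I F V}

namespace IsGenLieBialgebroid

/-- Linearity of the vanishing defect in `Y` gives `G ∧ Y = 0` for the Leibniz defect `G`, and in
rank at least two this forces `G = 0`. -/
theorem leibnizDefect_eq_zero (h : IsGenLieBialgebroid (dualPairing I F V) A φ A' X₀)
    (hF : 2 ≤ Module.finrank ℝ F) (X : Sec I F V) (f : Smooth I M)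
    (ξ : Sec I (F →L[ℝ] ℝ) (DualBundle V)) :
    leibnizDefect (dualPairing I F V) A A' φ X₀ X f ξ = 0 := by
  refine eq_zero_of_wedge_eq_zero hF _ (fun Y ξ η => ?_) ξ
  have h1 := compatDefect_smul_right (dualPairing I F V) A A' φ X₀ X Y f ξ η
  rw [h.compatDefect_eq_zero, h.compatDefect_eq_zero] at h1
  linear_combination -h1

/-- In rank at least two `⟨df, d_*g⟩` is antisymmetric in `f` and `g`. -/
theorem deriv_differential_add (h : IsGenLieBialgebroid (dualPairing I F V) A φ A' X₀)
    (hF : 2 ≤ Module.finrank ℝ F) (f g : Smooth I M) :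
    A'.deriv (differential (dualPairing I F V) A f) g
      + A'.deriv (differential (dualPairing I F V) A g) f = 0 := by
  set σ := A'.deriv (differential (dualPairing I F V) A f) g
      + A'.deriv (differential (dualPairing I F V) A g) f with hσ
  have key (X : Sec I F V) (ξ) : σ * dualPairing I F V X ξ = 0 := by
    have h1 := leibnizDefect_smul (dualPairing I F V) A A' φ X₀ X f g ξ
    rw [h.leibnizDefect_eq_zero hF, h.leibnizDefect_eq_zero hF, ← hσ] at h1
    linear_combination -h1
  ext x
  have hfin : FiniteDimensional ℝ (V x) :=
    (fiberEquiv F V x).symm.toLinearEquiv.finiteDimensional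
  have : Nontrivial (V x) := Module.nontrivial_of_finrank_pos (R := ℝ)
    (by rw [finrank_fiber F V x]; omega)
  obtain ⟨v, hv⟩ := exists_ne (0 : V x)
  obtain ⟨X, hX⟩ := exists_section_eq I F x v
  obtain ⟨ξ, hξ⟩ := exists_dual_section_ne_zero I F hv
  have h2 : σ x * ξ x (X x) = 0 := congrArg (fun f : Smooth I M => f x) (key X ξ)
  rw [hX] at h2
  exact (mul_eq_zero.1 h2).resolve_right hξ

theorem compatDefect_flip_eq_zero (h : IsGenLieBialgebroid (dualPairing I F V) A φ A' X₀)
    (ξ η : Sec I (F →L[ℝ] ℝ) (DualBundle V)) (X Y : Sec I F V) :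
    compatDefect (dualPairing I F V).flip A' A X₀ φ ξ η X Y = 0 := by
  obtain hF | hF := le_or_gt (Module.finrank ℝ F) 1
  · -- In rank at most one the defect of the exchanged pair vanishes for any two Lie algebroids.
    exact alternating_eq_zero_of_finrank_le_one hF
      (fun Y => compatDefectLinear (dualPairing I F V).flip A' A X₀ φ ξ η Y)
      (fun X Y => compatDefect_swap (dualPairing I F V).flip A' A X₀ φ ξ η Y X) Y X
  · have hc (X Y : Sec I F V) (ξ η) :=
      crossTerm_add_crossTerm_eq_zero (dualPairing I F V) A A' φ X₀ X Y ξ η h.pairing_bracket_sub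
        (h.deriv_differential_add hF) (h.leibnizDefect_eq_zero hF)
    have h1 := compatDefect_sub_compatDefect_flip (dualPairing I F V) A A' φ X₀ X Y ξ η
    rw [h.compatDefect_eq_zero] at h1
    linear_combination -h1 - hc X Y ξ η + hc X Y η ξ

end IsGenLieBialgebroid

end DualBundle

end GenLieBialgebroid

end

theorem theorem4p11
    {E : Type*} [NormedAddCommGroup E] [NormedSpace ℝ E] [FiniteDimensional ℝ E]
    {H : Type*} [TopologicalSpace H] {I : ModelWithCorners ℝ E H}
    {M : Type*} [TopologicalSpace M] [ChartedSpace H M] [IsManifold I ∞ M]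
    [BoundarylessManifold I M] [T2Space M]
    {F : Type*} [NormedAddCommGroup F] [NormedSpace ℝ F] [FiniteDimensional ℝ F]
    {V : M → Type*} [TopologicalSpace (TotalSpace F V)]
    [∀ x, TopologicalSpace (V x)] [∀ x, AddCommGroup (V x)] [∀ x, Module ℝ (V x)]
    [FiberBundle F V] [VectorBundle ℝ F V] [ContMDiffVectorBundle ∞ F V I]
    (A : LieAlgebroid I F V) (φ₀ : Sec I (F →L[ℝ] ℝ) (DualBundle V))
    (Astar : LieAlgebroid I (F →L[ℝ] ℝ) (DualBundle V)) (X₀ : Sec I F V)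
    (h : IsGenLieBialgebroid (dualPairing I F V) A φ₀ Astar X₀) :
    IsGenLieBialgebroid (dualPairing I F V).flip Astar X₀ A φ₀ where
  cocycle := h.cocycle'
  cocycle' := h.cocycle
  compat ξ η := (compat_iff_compatDefect_eq_zero _ _ _ _ _ ξ η).2 (h.compatDefect_flip_eq_zero ξ η)
  lie_add_lie _ Q := h.lie_add_lie_flip Q
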